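/- **Setting.** Let $A$ be a set of actions with a distinguished action $\surd\in A$ (successful termination). The signature $\Sigma_{PA}$ has the constants $0$ and $\varepsilon$; the $n$-ary prefix operators $a.\bigoplus_{i=1}^n[p_i]\_$ ($a\in A$, $n\ge 1$, $p_i\in(0,1]$, $\sum_i p_i=1$); and the binary operators $;$, $+$, $+_p$, $\mid$, $|||$, $|||_p$ ($p\in(0,1)$) and $\parallel_B$ ($B\subseteq A$). For a signature $\Sigma$ let $\mathsf T(\Sigma)$ be its set of closed terms and $\Delta(\mathsf T(\Sigma))$ the set of discrete probability distributions on it; $\delta(t)$ is the Dirac distribution, $\pi\oplus_p\pi'=p\pi+(1-p)\pi'$ (also written $\mu\oplus_p\nu$), and $f(\pi_1,\dots,\pi_n)$ is the image of the product distribution under $f$. The operational rules $R_{PA}$ are ($\xrightarrow{a}$ with $a\in A$ arbitrary unless restricted): - $\varepsilon\xrightarrow{\surd}\delta(0)$; $\quad a.\bigoplus_i[p_i]x_i\xrightarrow{a}\sum_i p_i\delta(x_i)$; no rule for $0$. - $x;y\xrightarrow{a}\mu;\delta(y)$ if $x\xrightarrow{a}\mu$, $a\ne\surd$; $\quad x;y\xrightarrow{a}\nu$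 if $x\xrightarrow{\surd}\mu$, $y\xrightarrow{a}\nu$. - $x+y\xrightarrow{a}\mu$ if $x\xrightarrow{a}\mu$; $\quad x+y\xrightarrow{a}\nu$ if $y\xrightarrow{a}\nu$. - $x+_py\xrightarrow{a}\mu$ if $x\xrightarrow{a}\mu$, $y\not\xrightarrow{a}$; $\quad x+_py\xrightarrow{a}\nu$ if $x\not\xrightarrow{a}$, $y\xrightarrow{a}\nu$; $\quad x+_py\xrightarrow{a}\mu\oplus_p\nu$ if $x\xrightarrow{a}\mu$, $y\xrightarrow{a}\nu$. - $x\mid y\xrightarrow{a}\mu\mid\nu$ if $x\xrightarrow{a}\mu$, $y\xrightarrow{a}\nu$, $a\neq\surd$. - $x\,|||\,y\xrightarrow{a}\mu\,|||\,\delta(y)$ if $x\xrightarrow{a}\mu$, $a\ne\surd$; $\quad x\,|||\,y\xrightarrow{a}\delta(x)\,|||\,\nu$ if $y\xrightarrow{a}\nu$, $a\ne\surd$. - $x\parallel_By\xrightarrow{a}\mu\parallel_B\nu$ if $x\xrightarrow{a}\mu$, $y\xrightarrow{a}\nu$, $a\in B\setminus\{\surd\}$; $\quad x\parallel_By\xrightarrow{a}\mu\parallel_B\delta(y)$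 if $x\xrightarrow{a}\mu$, $a\notin B\cup\{\surd\}$; $\quad x\parallel_By\xrightarrow{a}\delta(x)\parallel_B\nu$ if $y\xrightarrow{a}\nu$, $a\notin B\cup\{\surd\}$. - for $a\ne\surd$: $x\,|||_p\,y\xrightarrow{a}\mu\,|||_p\,\delta(y)$ if $x\xrightarrow{a}\mu$, $y\not\xrightarrow{a}$; $\quad x\,|||_p\,y\xrightarrow{a}\delta(x)\,|||_p\,\nu$ if $x\not\xrightarrow{a}$, $y\xrightarrow{a}\nu$; $\quad x\,|||_p\,y\xrightarrow{a}(\mu\,|||_p\,\delta(y))\oplus_p(\delta(x)\,|||_p\,\nu)$ if $x\xrightarrow{a}\mu$, $y\xrightarrow{a}\nu$. - for each $f\in\{\mid,|||,|||_p,\parallel_B\}$: $f(x,y)\xrightarrow{\surd}\delta(0)$ if $x\xrightarrow{\surd}\mu$, $y\xrightarrow{\surd}\nu$. A PGSOS rule for an $n$-ary operator $f$ has finitely many premises $x_i\xrightarrow{a}\mu$ and $x_i\not\xrightarrow{b}$ on the pairwise different arguments $x_1,\dots,x_n$, with pairwise different distribution variables $\mu$, and a conclusion $f(x_1,\dots,x_n)\xrightarrow{c}\theta$,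 where $\theta$ is built from these variables $\mu$ and from $\delta(t)$, $t$ a term over $x_1,\dots,x_n$, by convex combinations and operators. A specification $P=(\Sigma,A,R)$ is a set $R$ of such rules for operators of $\Sigma$, with finitely many rules for each operator and each label of the conclusion; it induces a unique transition relation on $\mathsf T(\Sigma)\times A\times\Delta(\mathsf T(\Sigma))$ consisting of exactly the transitions that are conclusions of instances of rules whose premises hold. $P$ is a disjoint extension of $P_{PA}=(\Sigma_{PA},A,R_{PA})$ if $\Sigma_{PA}\subseteq\Sigma$, $R_{PA}\subseteq R$, and $R$ has no further rule for an operator of $\Sigma_{PA}$. For $\lambda\in(0,1]$, a $\lambda$-bisimulation metric is a pseudometric $d:\mathsf T(\Sigma)^2\to[0,1]$ such that whenever $d(t,t')<1$ and $t\xrightarrow{a}\pi$ there is $t'\xrightarrow{a}\pi'$ with $\lambda\cdot\mathbf K(d)(\pi,\pi')\le d(t,t')$, where $\mathbf K(d)(\pi,\pi')$ is the minimum (infimum) of $\sum_{t,t'}d(t,t')\,\omega(t,t')$ over the distributions $\omega$ on $\mathsf T(\Sigma)^2$ with marginals $\pi,\pi'$. The $\lambda$-bisimilarity metric $\mathbf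 d$ is the pointwise smallest $\lambda$-bisimulation metric. **Theorem.** Let $P=(\Sigma,A,R)$ be a disjoint extension of $P_{PA}$ and $\lambda\in(0,1]$. Then the $\lambda$-bisimilarity metric $\mathbf d$ on $\mathsf T(\Sigma)$ exists, and every operator $f$ of $\Sigma_{PA}$ is non-expansive with respect to it: with $n$ the arity of $f$, $$\mathbf d\big(f(s_1,\dots,s_n),f(t_1,\dots,t_n)\big)\le\sum_{i=1}^n\mathbf d(s_i,t_i)\qquad\text{for all } s_i,t_i\in\mathsf T(\Sigma).$$ -/

import Mathlib

open scoped ENNReal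

universe u v w

namespace ProbPA

/-! ### Processes

State terms over a signature `L` and a set `V` of variables are `L.Term V`. -/

/-- A signature; its operators of rank `n` are the function symbols `L.Functions n` (relation
symbols play no role). -/
abbrev Signature := FirstOrder.Language.{u, 0}

/-- Processes are closed state terms. -/
abbrev Proc (L : Signature.{u}) : Type u := L.Term Empty

/-- The product `π₁ ⊗ ⋯ ⊗ πₙ` of finitely many discrete distributions. -/
noncomputable def prodPMF {X : Type u} : {n : ℕ} → (Fin n → PMF X) → PMF (Fin n → X)
  | 0, _ => PMF.pure Fin.elim0
  | _ + 1, π => (π 0).bind fun x => (prodPMF fun i => π i.succ).map fun xs => Fin.cons x xs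

theorem prodPMF_apply {X : Type u} {n : ℕ} (π : Fin n → PMF X) (x : Fin n → X) :
    prodPMF π x = ∏ i, π i (x i) := by
  classical
  induction n with
  | zero =>
    have : x = Fin.elim0 := Subsingleton.elim _ _
    simp [prodPMF, this]
  | succ n ih =>
    rw [prodPMF, PMF.bind_apply, Fin.prod_univ_succ, tsum_eq_single (x 0)]
    · congr 1
      rw [PMF.map_apply, tsum_eq_single (fun i => x i.succ)]
      · rw [if_pos, ih]
        exact (Fin.cons_self_tail x).symm
      · intro y hy
        rw [if_neg]
        intro h
        exact hy (by rw [h]; simp)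
    · intro y hy
      rw [PMF.map_apply]
      refine mul_eq_zero_of_right _ (ENNReal.tsum_eq_zero.2 fun z => if_neg ?_)
      intro h
      exact hy (by rw [h]; simp)

/-- The two-point distribution giving `p` to `0` and `1 - p` to `1`. -/
noncomputable def coin (p : ℝ≥0∞) (hp : p ≤ 1) : PMF (Fin 2) :=
  PMF.ofFintype ![p, 1 - p] (by simp [Fin.sum_univ_two, hp])

/-- Distribution terms over state variables `Vs` and distribution variables `Vd`.
The weights of a convex combination form a distribution on its index set. -/
inductive DTerm (L : Signature.{u}) (Vs Vd : Type) : Type (max u 1)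
  | var (μ : Vd) : DTerm L Vs Vd
  | dirac (t : L.Term Vs) : DTerm L Vs Vd
  | sum {I : Type} (p : PMF I) (θ : I → DTerm L Vs Vd) : DTerm L Vs Vd
  | app {n : ℕ} (f : L.Functions n) (θ : Fin n → DTerm L Vs Vd) : DTerm L Vs Vd

namespace DTerm

variable {L : Signature.{u}} {Vs Vd : Type}

/-- The convex combination `θ₁ ⊕_p θ₂`. -/
noncomputable def choice (p : ℝ≥0∞) (hp : p ≤ 1) (θ₁ θ₂ : DTerm L Vs Vd) : DTerm L Vs Vd :=
  .sum (coin p hp) ![θ₁, θ₂]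

/-- The distribution denoted by a distribution term under a closed substitution.
Every distribution is denoted by a closed distribution term (a convex combination of Dirac
distributions), so distribution variables are instantiated directly by distributions. -/
noncomputable def eval (σ : Vs → Proc L) (ρ : Vd → PMF (Proc L)) :
    DTerm L Vs Vd → PMF (Proc L)
  | var μ => ρ μ
  | dirac t => PMF.pure (t.subst σ)
  | sum p θ => p.bind fun i => eval σ ρ (θ i)
  | app f θ => (prodPMF fun i => eval σ ρ (θ i)).map fun ts => FirstOrder.Language.Term.func f ts

/-- Transport of a distribution term along an inclusion of signatures. -/
noncomputable def onLHom {L' : Signature.{w}} (ι : L.LHom L') :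
    DTerm L Vs Vd → DTerm L' Vs Vd
  | var μ => .var μ
  | dirac t => .dirac (ι.onTerm t)
  | sum p θ => .sum p fun i => onLHom ι (θ i)
  | app f θ => .app (ι.onFunction f) fun i => onLHom ι (θ i)

end DTerm

/-! ### Transition systems and their specification by PGSOS rules -/

/-- The transition relation of a PTS: `M t a π` says `t —a→ π`. -/
abbrev PTS (L : Signature.{u}) (A : Type v) := Proc L → A → PMF (Proc L) → Prop

/-- A PGSOS rule for an operator of rank `n`.  Variables are numbered: the source variables are
`x_i`, `i : Fin n`, and the `k`-th positive premise `x_i —a→ μ_k` is given by `pos k = (i, a)`.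
Thus all variables are pairwise different, and only they may occur in the target. A pair
`(i, b)` in `neg` stands for the negative premise "`x_i` has no `b`-transition". -/
structure PGSOSRule (L : Signature.{u}) (A : Type v) (n : ℕ) where
  numPos : ℕ
  pos : Fin numPos → Fin n × A
  neg : Finset (Fin n × A)
  act : A
  target : DTerm L (Fin n) (Fin numPos)

namespace PGSOSRule

variable {L : Signature.{u}} {A : Type v} {n : ℕ}

/-- The premises of `r` hold in `M` when `x_i` is `ts i` and `μ_k` is `ρ k`. -/
def Premises (r : PGSOSRule L A n) (M : PTS L A) (ts : Fin n → Proc L)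
    (ρ : Fin r.numPos → PMF (Proc L)) : Prop :=
  (∀ k, M (ts (r.pos k).1) (r.pos k).2 (ρ k)) ∧
    ∀ q ∈ r.neg, ∀ π, ¬ M (ts q.1) q.2 π

/-- Transport of a rule along an inclusion of signatures. -/
noncomputable def onLHom {L' : Signature.{w}} (ι : L.LHom L')
    (r : PGSOSRule L A n) : PGSOSRule L' A n where
  numPos := r.numPos
  pos := r.pos
  neg := r.neg
  act := r.act
  target := r.target.onLHom ι

end PGSOSRule

/-- A PTSS in PGSOS format; `rules f` is the set of rules with source `f(x₁,…,xₙ)`. -/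
structure PTSS (L : Signature.{u}) (A : Type v) where
  rules : ∀ {n : ℕ}, L.Functions n → Set (PGSOSRule L A n)
  finite_rules : ∀ {n : ℕ} (f : L.Functions n) (a : A), {r ∈ rules f | r.act = a}.Finite

namespace PTSS

variable {L : Signature.{u}} {A : Type v}

/-- In `M`, some instance of a rule of `P` with valid premises has conclusion `t —a→ π`. -/
def Supports (P : PTSS L A) (M : PTS L A) (t : Proc L) (a : A) (π : PMF (Proc L)) : Prop :=
  ∃ (n : ℕ) (f : L.Functions n) (ts : Fin n → Proc L), ∃ r ∈ P.rules f,
    ∃ ρ : Fin r.numPos → PMF (Proc L), r.Premises M ts ρ ∧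
      t = FirstOrder.Language.Term.func f ts ∧ a = r.act ∧ π = r.target.eval ts ρ

/-- `M` contains all and only the transitions supported by `P`. -/
def IsSupportedModel (P : PTSS L A) (M : PTS L A) : Prop :=
  ∀ t a π, M t a π ↔ P.Supports M t a π

/-- The induced model of `P`, by recursion on the source term; it is the unique supported
model (`isSupportedModel_iff`). -/
def inducedModel (P : PTSS L A) : PTS L A
  | .var x, _, _ => x.elim
  | .func f ts, a, π => ∃ r ∈ P.rules f, ∃ ρ : Fin r.numPos → PMF (Proc L),
      ((∀ k, inducedModel P (ts (r.pos k).1) (r.pos k).2 (ρ k)) ∧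
        ∀ q ∈ r.neg, ∀ π', ¬ inducedModel P (ts q.1) q.2 π') ∧
      a = r.act ∧ π = r.target.eval ts ρ

theorem isSupportedModel_inducedModel (P : PTSS L A) : P.IsSupportedModel P.inducedModel := by
  intro t a π
  cases t with
  | var x => exact x.elim
  | func f ts =>
    rw [inducedModel]
    constructor
    · rintro ⟨r, hr, ρ, hp, ha, hπ⟩
      exact ⟨_, f, ts, r, hr, ρ, hp, rfl, ha, hπ⟩
    · rintro ⟨n, f', ts', r, hr, ρ, hp, ht, ha, hπ⟩
      cases ht
      exact ⟨r, hr, ρ, hp, ha, hπ⟩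

theorem isSupportedModel_iff (P : PTSS L A) (M : PTS L A) :
    P.IsSupportedModel M ↔ M = P.inducedModel := by
  refine ⟨fun h => ?_, fun h => h ▸ P.isSupportedModel_inducedModel⟩
  funext t
  induction t with
  | var x => exact x.elim
  | func f ts ih =>
    funext a π
    rw [inducedModel]
    refine propext ((h _ _ _).trans ⟨?_, ?_⟩)
    · rintro ⟨n, f', ts', r, hr, ρ, hp, ht, ha, hπ⟩
      cases ht
      simp only [PGSOSRule.Premises, ih] at hp
      exact ⟨r, hr, ρ, hp, ha, hπ⟩
    · rintro ⟨r, hr, ρ, hp, ha, hπ⟩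
      refine ⟨_, f, ts, r, hr, ρ, ?_, rfl, ha, hπ⟩
      simpa only [PGSOSRule.Premises, ih] using hp

/-- `P₂` is a disjoint extension of `P₁` along the inclusion `ι` of signatures: it has the rules
of `P₁`, and no other rule for an operator of `P₁`. -/
structure IsDisjointExtension {L₁ : Signature.{w}} {L₂ : Signature.{u}} {A : Type v}
    (ι : L₁.LHom L₂) (P₁ : PTSS L₁ A) (P₂ : PTSS L₂ A) : Prop where
  injective : ∀ n, Function.Injective fun f : L₁.Functions n => ι.onFunction f
  rules_eq : ∀ {n : ℕ} (f : L₁.Functions n),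
    P₂.rules (ι.onFunction f) = PGSOSRule.onLHom ι '' P₁.rules f

end PTSS

/-! ### The bisimilarity metric

Distances in `[0,1]` are represented by functions into `ℝ≥0∞` bounded by `1`. -/

/-- `1`-bounded pseudometrics. -/
structure IsPseudometric {X : Type u} (d : X → X → ℝ≥0∞) : Prop where
  le_one : ∀ x y, d x y ≤ 1
  refl : ∀ x, d x x = 0
  symm : ∀ x y, d x y = d y x
  triangle : ∀ x y z, d x z ≤ d x y + d y z

/-- The matchings of two distributions. -/
def Matchings {X : Type u} (π π' : PMF X) : Set (PMF (X × X)) :=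
  {ω | ω.map Prod.fst = π ∧ ω.map Prod.snd = π'}

/-- The Kantorovich lifting. -/
noncomputable def kantorovich {X : Type u} (d : X → X → ℝ≥0∞) (π π' : PMF X) : ℝ≥0∞ :=
  ⨅ ω ∈ Matchings π π', ∑' x : X × X, d x.1 x.2 * ω x

/-- `d` is a `lam`-bisimulation metric on the PTS `M`. -/
structure IsBisimMetric {L : Signature.{u}} {A : Type v} (M : PTS L A) (lam : ℝ≥0∞)
    (d : Proc L → Proc L → ℝ≥0∞) : Prop where
  pseudometric : IsPseudometric d
  transfer : ∀ t t', d t t' < 1 → ∀ a π, M t a π →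
    ∃ π', M t' a π' ∧ lam * kantorovich d π π' ≤ d t t'

/-- `d` is the `lam`-bisimilarity metric: the smallest `lam`-bisimulation metric in the
pointwise order. -/
def IsBisimilarityMetric {L : Signature.{u}} {A : Type v} (M : PTS L A) (lam : ℝ≥0∞)
    (d : Proc L → Proc L → ℝ≥0∞) : Prop :=
  IsLeast {e | IsBisimMetric M lam e} d

/-- The operator `f` is non-expansive with respect to `d`. -/
def NonExpansive {L : Signature.{u}} (d : Proc L → Proc L → ℝ≥0∞) {n : ℕ}
    (f : L.Functions n) : Prop :=
  ∀ s t : Fin n → Proc L,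
    d (FirstOrder.Language.Term.func f s) (FirstOrder.Language.Term.func f t) ≤ ∑ i, d (s i) (t i)

/-! ### The process algebra `PA` -/

/-- The operators of `Σ_PA`, indexed by rank. In `pre` the weights `pᵢ` are given as a
distribution on `Fin n` of full support, which forces `n ≥ 1`. -/
inductive PAOp (A : Type v) : ℕ → Type v
  | nil : PAOp A 0
  | skip : PAOp A 0
  | pre (a : A) {n : ℕ} (p : PMF (Fin n)) (hp : ∀ i, 0 < p i) : PAOp A n
  | seq : PAOp A 2
  | alt : PAOp A 2
  | palt (p : ℝ≥0∞) (hp₀ : 0 < p) (hp₁ : p < 1) : PAOp A 2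
  | sync : PAOp A 2
  | async : PAOp A 2
  | pasync (p : ℝ≥0∞) (hp₀ : 0 < p) (hp₁ : p < 1) : PAOp A 2
  | csp (B : Set A) : PAOp A 2

/-- The signature `Σ_PA`. -/
def paSig (A : Type v) : Signature.{v} := ⟨PAOp A, fun _ => Empty⟩

section Rules

variable {A : Type v}

/-- Distribution terms in the targets of rules for binary operators with `k` positive
premises. -/
abbrev Tgt (A : Type v) (k : ℕ) := DTerm (paSig A) (Fin 2) (Fin k)

/-- `θ₁ f θ₂`. -/
def bin {k : ℕ} (f : PAOp A 2) (θ₁ θ₂ : Tgt A k) : Tgt A k :=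
  DTerm.app (L := paSig A) f ![θ₁, θ₂]

/-- `δ(x)`, for `x` the first source variable. -/
def dx {k : ℕ} : Tgt A k := .dirac (.var 0)

/-- `δ(y)`, for `y` the second source variable. -/
def dy {k : ℕ} : Tgt A k := .dirac (.var 1)

/-- `δ(0)`. -/
def dnil {m k : ℕ} : DTerm (paSig A) (Fin m) (Fin k) :=
  .dirac (.func (L := paSig A) PAOp.nil Fin.elim0)

/-- The rule with premise `x —a→ μ` and conclusion `f(x,y) —a→ θ`, with `μ = .var 0`. -/
def ruleL (a : A) (θ : Tgt A 1) : PGSOSRule (paSig A) A 2 :=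
  ⟨1, ![(0, a)], ∅, a, θ⟩

/-- The rule with premise `y —a→ ν` and conclusion `f(x,y) —a→ θ`, with `ν = .var 0`. -/
def ruleR (a : A) (θ : Tgt A 1) : PGSOSRule (paSig A) A 2 :=
  ⟨1, ![(1, a)], ∅, a, θ⟩

/-- As `ruleL`, with the additional premise that `y` has no `a`-transition. -/
def ruleLneg (a : A) (θ : Tgt A 1) : PGSOSRule (paSig A) A 2 :=
  ⟨1, ![(0, a)], {(1, a)}, a, θ⟩

/-- As `ruleR`, with the additional premise that `x` has no `a`-transition. -/
def ruleRneg (a : A) (θ : Tgt A 1) : PGSOSRule (paSig A) A 2 :=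
  ⟨1, ![(1, a)], {(0, a)}, a, θ⟩

/-- The rule with premises `x —b→ μ`, `y —a→ ν` and conclusion `f(x,y) —a→ θ`, with
`μ = .var 0` and `ν = .var 1`. -/
def ruleLR (b a : A) (θ : Tgt A 2) : PGSOSRule (paSig A) A 2 :=
  ⟨2, ![(0, b), (1, a)], ∅, a, θ⟩

/-- The rules of `PA`; `tick` is the successful termination action. -/
noncomputable def paRules (tick : A) : {n : ℕ} → PAOp A n → Set (PGSOSRule (paSig A) A n)
  | _, .nil => ∅
  | _, .skip => {⟨0, Fin.elim0, ∅, tick, dnil⟩}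
  | _, .pre a p _ => {⟨0, Fin.elim0, ∅, a, .sum p fun i => .dirac (.var i)⟩}
  | _, .seq =>
      {r | ∃ a, a ≠ tick ∧ r = ruleL a (bin .seq (.var 0) dy)} ∪
      {r | ∃ a, r = ruleLR tick a (.var 1)}
  | _, .alt =>
      {r | ∃ a, r = ruleL a (.var 0)} ∪
      {r | ∃ a, r = ruleR a (.var 0)}
  | _, .palt p _ h =>
      {r | ∃ a, r = ruleLneg a (.var 0)} ∪
      {r | ∃ a, r = ruleRneg a (.var 0)} ∪
      {r | ∃ a, r = ruleLR a a (.choice p h.le (.var 0) (.var 1))}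
  | _, .sync =>
      {r | ∃ a, a ≠ tick ∧ r = ruleLR a a (bin .sync (.var 0) (.var 1))} ∪
      {ruleLR tick tick dnil}
  | _, .async =>
      {r | ∃ a, a ≠ tick ∧ r = ruleL a (bin .async (.var 0) dy)} ∪
      {r | ∃ a, a ≠ tick ∧ r = ruleR a (bin .async dx (.var 0))} ∪
      {ruleLR tick tick dnil}
  | _, .pasync p h₀ h =>
      {r | ∃ a, a ≠ tick ∧ r = ruleLneg a (bin (.pasync p h₀ h) (.var 0) dy)} ∪
      {r | ∃ a, a ≠ tick ∧ r = ruleRneg a (bin (.pasync p h₀ h) dx (.var 0))} ∪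
      {r | ∃ a, a ≠ tick ∧ r = ruleLR a a (.choice p h.le
        (bin (.pasync p h₀ h) (.var 0) dy) (bin (.pasync p h₀ h) dx (.var 1)))} ∪
      {ruleLR tick tick dnil}
  | _, .csp B =>
      {r | ∃ a, a ∈ B \ {tick} ∧ r = ruleLR a a (bin (.csp B) (.var 0) (.var 1))} ∪
      {ruleLR tick tick dnil} ∪
      {r | ∃ a, a ∉ B ∪ {tick} ∧ r = ruleL a (bin (.csp B) (.var 0) dy)} ∪
      {r | ∃ a, a ∉ B ∪ {tick} ∧ r = ruleR a (bin (.csp B) dx (.var 0))}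

/-- The specification `P_PA`. -/
noncomputable def paPTSS (tick : A) : PTSS (paSig A) A where
  rules f := paRules tick f
  finite_rules {n} f a := by
    have key : ∀ (p : A → Prop) (g : A → PGSOSRule (paSig A) A 2),
        (∀ b, (g b).act = b) → {r ∈ {r | ∃ b, p b ∧ r = g b} | r.act = a}.Finite := by
      intro p g hg
      refine (Set.finite_singleton (g a)).subset ?_
      rintro r ⟨⟨b, -, rfl⟩, hb⟩
      rw [hg] at hb
      rw [hb]; rfl
    have key' : ∀ (g : A → PGSOSRule (paSig A) A 2),
        (∀ b, (g b).act = b) → {r ∈ {r | ∃ b, r = g b} | r.act = a}.Finite := by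
      intro g hg
      simpa using key (fun _ => True) g hg
    have one : ∀ {m : ℕ} (q : PGSOSRule (paSig A) A m),
        {r ∈ ({q} : Set (PGSOSRule (paSig A) A m)) | r.act = a}.Finite :=
      fun q => (Set.finite_singleton q).subset fun _ h => h.1
    have cup : ∀ {m : ℕ} {s t : Set (PGSOSRule (paSig A) A m)},
        {r ∈ s | r.act = a}.Finite → {r ∈ t | r.act = a}.Finite →
          {r ∈ s ∪ t | r.act = a}.Finite := by
      intro m s t hs ht
      refine (hs.union ht).subset ?_
      rintro r ⟨h | h, hr⟩
      exacts [Or.inl ⟨h, hr⟩, Or.inr ⟨h, hr⟩]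
    cases f with
    | nil => exact Set.finite_empty.subset fun _ h => h.1
    | skip => exact one _
    | pre b p hp => exact one _
    | seq => exact cup (key _ _ fun _ => rfl) (key' _ fun _ => rfl)
    | alt => exact cup (key' _ fun _ => rfl) (key' _ fun _ => rfl)
    | palt p h₀ h =>
      exact cup (cup (key' _ fun _ => rfl) (key' _ fun _ => rfl)) (key' _ fun _ => rfl)
    | sync => exact cup (key _ _ fun _ => rfl) (one _)
    | async => exact cup (cup (key _ _ fun _ => rfl) (key _ _ fun _ => rfl)) (one _)
    | pasync p h₀ h =>
      exact cup (cup (cup (key _ _ fun _ => rfl) (key _ _ fun _ => rfl))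
        (key _ _ fun _ => rfl)) (one _)
    | csp B =>
      exact cup (cup (cup (key _ _ fun _ => rfl) (one _)) (key _ _ fun _ => rfl))
        (key _ _ fun _ => rfl)

end Rules

end ProbPA

/-!
For the functional `Φ` sending `d` to the truncated, symmetrised cost of simulating transitions
with respect to `λ · K(d)`, the `λ`-bisimulation metrics on an image-finite system are the
pseudometrics `d` with `Φ d ≤ d`, so the bisimilarity metric is the least fixed point of `Φ`. As
`Φ` preserves pseudometrics, the induction principle for least fixed points shows that `lfp Φ` is
a pseudometric, and the same principle gives non-expansiveness: if the operators are
non-expansive for some `d ≤ Φ d`, they are so for `Φ d`. Indeed a transition of `f(s₁,…,sₙ)` is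
simulated from `f(t₁,…,tₙ)` by an instance of the same rule, and `λ · K(d)` of the two targets is
at most the total weight of the variables occurring in the target of the rule, where `xᵢ` and the
distributions reached from `xᵢ` have weight `Φ d (sᵢ, tᵢ)`. In each rule of `PA` every argument is
used at most once, directly or through a derivative, so this is at most `∑ᵢ Φ d (sᵢ, tᵢ)`.
-/

namespace ProbPA

/-! ### Couplings and the Kantorovich lifting -/

section Coupling

variable {X Y Z : Type*}

theorem tsum_mul_bind (c : Y → ℝ≥0∞) (p : PMF X) (f : X → PMF Y) :
    ∑' y, c y * p.bind f y = ∑' x, p x * ∑' y, c y * f x y := by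
  simp only [PMF.bind_apply, ← ENNReal.tsum_mul_left, mul_left_comm (c _)]
  exact ENNReal.tsum_comm

theorem tsum_mul_pure (c : X → ℝ≥0∞) (x : X) : ∑' y, c y * PMF.pure x y = c x := by
  rw [tsum_eq_single x fun y hy => by rw [PMF.pure_apply_of_ne _ _ hy, mul_zero],
    PMF.pure_apply_self, mul_one]

theorem tsum_mul_map (c : Y → ℝ≥0∞) (p : PMF X) (f : X → Y) :
    ∑' y, c y * p.map f y = ∑' x, c (f x) * p x := by
  simp only [← PMF.bind_pure_comp, tsum_mul_bind, Function.comp_apply, tsum_mul_pure, mul_comm]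

theorem map_fst_apply (ω : PMF (X × Y)) (x : X) :
    ω.map Prod.fst x = ∑' y, ω (x, y) := by
  classical
  rw [PMF.map_apply, ENNReal.tsum_prod', tsum_eq_single x fun b hb => by simp [hb.symm]]
  simp

/-- Division by the mass of the fibre over `x`; over a null fibre any distribution will do. -/
theorem exists_conditional (ω : PMF (X × Y)) (x : X) :
    ∃ κ : PMF Y, ∀ y, ω.map Prod.fst x * κ y = ω (x, y) := by
  by_cases hx : ω.map Prod.fst x = 0
  · refine ⟨ω.map Prod.snd, fun y => ?_⟩
    rw [hx, zero_mul, ENNReal.tsum_eq_zero.1 ((map_fst_apply ω x).symm.trans hx) y]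
  · have hx_top := (ω.map Prod.fst).apply_ne_top x
    rw [map_fst_apply] at hx hx_top ⊢
    refine ⟨PMF.normalize (fun y => ω (x, y)) hx hx_top, fun y => ?_⟩
    rw [PMF.normalize_apply, mul_left_comm, ENNReal.mul_inv_cancel hx hx_top, mul_one]

theorem exists_disintegration (ω : PMF (X × Y)) :
    ∃ κ : X → PMF Y, ((ω.map Prod.fst).bind fun x => (κ x).map (Prod.mk x)) = ω := by
  classical
  choose κ hκ using exists_conditional ω
  refine ⟨κ, PMF.ext fun ⟨x, y⟩ => ?_⟩
  have hfibre : ∀ x', (κ x').map (Prod.mk x') (x, y) = if x' = x then κ x y else 0 := by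
    intro x'
    rw [PMF.map_apply]
    refine (tsum_eq_single y fun z hz => if_neg fun h => hz (Prod.mk.inj h).2.symm).trans ?_
    by_cases h : x' = x
    · simp [h]
    · simp [h, Ne.symm h]
  rw [PMF.bind_apply, ← hκ, tsum_eq_single x fun x' hx' => by rw [hfibre, if_neg hx', mul_zero],
    hfibre, if_pos rfl]

theorem exists_gluing {ω : PMF (X × Y)} {ω' : PMF (Y × Z)}
    (h : ω.map Prod.snd = ω'.map Prod.fst) :
    ∃ γ : PMF (X × Y × Z), γ.map (fun p => (p.1, p.2.1)) = ω ∧ γ.map Prod.snd = ω' := by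
  obtain ⟨κ, hκ⟩ := exists_disintegration ω'
  refine ⟨ω.bind fun p => (κ p.2).map fun z => (p.1, p.2, z), ?_, ?_⟩
  · simp only [PMF.map_bind, PMF.map_comp]
    exact (congrArg ω.bind (funext fun p => PMF.map_const (κ p.2) p)).trans ω.bind_pure
  · simp only [PMF.map_bind, PMF.map_comp]
    rw [← hκ, ← h, PMF.bind_map]
    rfl

theorem matchings_nonempty (π π' : PMF X) : (Matchings π π').Nonempty := by
  refine ⟨π.bind fun x => π'.map fun y => (x, y), ?_, ?_⟩
  · simp only [PMF.map_bind, PMF.map_comp]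
    exact (congrArg π.bind (funext fun x => PMF.map_const π' x)).trans π.bind_pure
  · simp only [PMF.map_bind, PMF.map_comp, Function.comp_def, PMF.bind_const]
    exact π'.map_id

end Coupling

section Kantorovich

variable {X Y : Type u}

theorem kantorovich_le_of_mem_matchings (d : X → X → ℝ≥0∞) {π π' : PMF X} {ω : PMF (X × X)}
    (h : ω ∈ Matchings π π') : kantorovich d π π' ≤ ∑' x : X × X, d x.1 x.2 * ω x :=
  iInf₂_le ω h

theorem exists_mem_matchings_le_add (d : X → X → ℝ≥0∞) (π π' : PMF X) {ε : ℝ≥0∞} (hε : ε ≠ 0) :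
    ∃ ω ∈ Matchings π π', ∑' x : X × X, d x.1 x.2 * ω x ≤ kantorovich d π π' + ε := by
  by_cases hK : kantorovich d π π' = ⊤
  · obtain ⟨ω, hω⟩ := matchings_nonempty π π'
    exact ⟨ω, hω, by simp [hK]⟩
  · obtain ⟨ω, hω_lt⟩ := iInf_lt_iff.1 (ENNReal.lt_add_right hK hε)
    obtain ⟨hω, hlt⟩ := iInf_lt_iff.1 hω_lt
    exact ⟨ω, hω, hlt.le⟩

theorem kantorovich_mono {c d : X → X → ℝ≥0∞} (h : c ≤ d) (π π' : PMF X) :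
    kantorovich c π π' ≤ kantorovich d π π' :=
  iInf₂_mono fun _ _ => ENNReal.tsum_le_tsum fun x => mul_le_mul_left (h x.1 x.2) _

theorem kantorovich_const_add_le (a : ℝ≥0∞) (d : X → X → ℝ≥0∞) (π π' : PMF X) :
    kantorovich (fun x y => a + d x y) π π' ≤ a + kantorovich d π π' := by
  simp only [kantorovich, ENNReal.add_iInf]
  refine iInf₂_mono fun ω _ => ?_
  simp only [add_mul, ENNReal.tsum_add, ENNReal.tsum_mul_left, ω.tsum_coe, mul_one, le_refl]

theorem kantorovich_pure_le (d : X → X → ℝ≥0∞) (x y : X) :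
    kantorovich d (PMF.pure x) (PMF.pure y) ≤ d x y := by
  have hω : PMF.pure (x, y) ∈ Matchings (PMF.pure x) (PMF.pure y) :=
    ⟨PMF.pure_map _ _, PMF.pure_map _ _⟩
  exact (kantorovich_le_of_mem_matchings d hω).trans_eq
    (tsum_mul_pure (fun z : X × X => d z.1 z.2) (x, y))

theorem kantorovich_self {d : X → X → ℝ≥0∞} (h : ∀ x, d x x = 0) (π : PMF X) :
    kantorovich d π π = 0 := by
  have hω : π.map (fun x => (x, x)) ∈ Matchings π π :=
    ⟨(PMF.map_comp _ _ _).trans π.map_id, (PMF.map_comp _ _ _).trans π.map_id⟩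
  refine le_antisymm ((kantorovich_le_of_mem_matchings d hω).trans_eq ?_) zero_le
  simp only [tsum_mul_map (fun z : X × X => d z.1 z.2), h, zero_mul, tsum_zero]

theorem kantorovich_triangle {d : X → X → ℝ≥0∞} (h : ∀ x y z, d x z ≤ d x y + d y z)
    (π₁ π₂ π₃ : PMF X) :
    kantorovich d π₁ π₃ ≤ kantorovich d π₁ π₂ + kantorovich d π₂ π₃ := by
  simp only [kantorovich, ENNReal.add_iInf, ENNReal.iInf_add]
  refine le_iInf₂ fun ω' hω' => le_iInf₂ fun ω hω => ?_
  obtain ⟨γ, rfl, rfl⟩ := exists_gluing (hω.2.trans hω'.1.symm)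
  have hγ : γ.map (fun p => (p.1, p.2.2)) ∈ Matchings π₁ π₃ := by
    refine ⟨?_, ?_⟩
    · rw [← hω.1, PMF.map_comp, PMF.map_comp]; rfl
    · rw [← hω'.2, PMF.map_comp, PMF.map_comp]; rfl
  refine (iInf₂_le _ hγ).trans ?_
  simp only [tsum_mul_map (fun z : X × X => d z.1 z.2), ← ENNReal.tsum_add, ← add_mul]
  exact ENNReal.tsum_le_tsum fun p => mul_le_mul_left (h _ _ _) _

theorem kantorovich_map_le (d : Y → Y → ℝ≥0∞) (f g : X → Y) (π π' : PMF X) :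
    kantorovich d (π.map f) (π'.map g) ≤ kantorovich (fun x y => d (f x) (g y)) π π' := by
  refine le_iInf₂ fun ω hω => ?_
  have hfg : ω.map (Prod.map f g) ∈ Matchings (π.map f) (π'.map g) := by
    refine ⟨?_, ?_⟩
    · rw [← hω.1, PMF.map_comp, PMF.map_comp]; rfl
    · rw [← hω.2, PMF.map_comp, PMF.map_comp]; rfl
  exact (kantorovich_le_of_mem_matchings d hfg).trans_eq
    (tsum_mul_map (fun z : Y × Y => d z.1 z.2) ω _)

theorem kantorovich_bind_le {I : Type*} (d : X → X → ℝ≥0∞) (p : PMF I) (f g : I → PMF X) :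
    kantorovich d (p.bind f) (p.bind g) ≤ ∑' i, p i * kantorovich d (f i) (g i) := by
  refine ENNReal.le_of_forall_pos_le_add fun ε hε _ => ?_
  choose η hη hle using fun i => exists_mem_matchings_le_add d (f i) (g i)
    (ENNReal.coe_ne_zero.2 hε.ne')
  have hmix : p.bind η ∈ Matchings (p.bind f) (p.bind g) :=
    ⟨(PMF.map_bind ..).trans (congrArg _ (funext fun i => (hη i).1)),
      (PMF.map_bind ..).trans (congrArg _ (funext fun i => (hη i).2))⟩
  calc kantorovich d (p.bind f) (p.bind g)
      ≤ ∑' x : X × X, d x.1 x.2 * p.bind η x := kantorovich_le_of_mem_matchings d hmix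
    _ = ∑' i, p i * ∑' x : X × X, d x.1 x.2 * η i x := tsum_mul_bind _ p η
    _ ≤ ∑' i, p i * (kantorovich d (f i) (g i) + ε) := by gcongr with i; exact hle i
    _ = (∑' i, p i * kantorovich d (f i) (g i)) + ε := by
      simp only [mul_add, ENNReal.tsum_add, ENNReal.tsum_mul_right, p.tsum_coe, one_mul]

theorem kantorovich_bind_le_add {c : X → X → ℝ≥0∞} {d : Y → Y → ℝ≥0∞} {f g : X → PMF Y}
    {b : ℝ≥0∞} (h : ∀ x y, kantorovich d (f x) (g y) ≤ c x y + b) (π π' : PMF X) :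
    kantorovich d (π.bind f) (π'.bind g) ≤ kantorovich c π π' + b := by
  conv_rhs => simp only [kantorovich, ENNReal.iInf_add]
  refine le_iInf₂ fun ω hω => ?_
  rw [← hω.1, ← hω.2, PMF.bind_map, PMF.bind_map]
  calc kantorovich d (ω.bind (f ∘ Prod.fst)) (ω.bind (g ∘ Prod.snd))
      ≤ ∑' x, ω x * kantorovich d (f x.1) (g x.2) := kantorovich_bind_le d ω _ _
    _ ≤ ∑' x, ω x * (c x.1 x.2 + b) := by gcongr with x; exact h _ _
    _ = (∑' x, c x.1 x.2 * ω x) + b := by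
      simp only [mul_comm (ω _), add_mul, ENNReal.tsum_add, ENNReal.tsum_mul_left, ω.tsum_coe,
        mul_one]

theorem kantorovich_prodPMF_le (d : X → X → ℝ≥0∞) {n : ℕ} (π π' : Fin n → PMF X) :
    kantorovich (fun x y : Fin n → X => ∑ i, d (x i) (y i)) (prodPMF π) (prodPMF π') ≤
      ∑ i, kantorovich d (π i) (π' i) := by
  induction n with
  | zero => exact (kantorovich_pure_le _ _ _).trans (by simp)
  | succ n ih =>
    rw [Fin.sum_univ_succ, prodPMF, prodPMF]
    refine kantorovich_bind_le_add (fun x y => ?_) _ _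
    refine (kantorovich_map_le _ _ _ _ _).trans ?_
    simp only [Fin.sum_univ_succ, Fin.cons_zero, Fin.cons_succ]
    exact (kantorovich_const_add_le _ _ _ _).trans (add_le_add_right (ih _ _) _)

end Kantorovich

/-! ### The bisimilarity metric as a least fixed point -/

section Pseudometric

variable {X : Type u}

theorem isPseudometric_sSup {S : Set (X → X → ℝ≥0∞)} (hS : ∀ d ∈ S, IsPseudometric d) :
    IsPseudometric (sSup S) where
  le_one x y := by
    simp only [sSup_apply, iSup_apply]
    exact iSup_le fun d => (hS d d.2).le_one x y
  refl x := by
    simp only [sSup_apply, iSup_apply]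
    exact le_antisymm (iSup_le fun d => ((hS d d.2).refl x).le) zero_le
  symm x y := by
    simp only [sSup_apply, iSup_apply]
    exact iSup_congr fun d => (hS d d.2).symm x y
  triangle x y z := by
    simp only [sSup_apply, iSup_apply]
    refine iSup_le fun d => ((hS d d.2).triangle x y z).trans (add_le_add ?_ ?_)
    · exact le_iSup (fun e : S => (e : X → X → ℝ≥0∞) x y) d
    · exact le_iSup (fun e : S => (e : X → X → ℝ≥0∞) y z) d

theorem isPseudometric_min_one_max {c : X → X → ℝ≥0∞} (hrefl : ∀ x, c x x = 0)
    (htri : ∀ x y z, c x z ≤ c x y + c y z) :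
    IsPseudometric fun x y => min 1 (max (c x y) (c y x)) where
  le_one _ _ := min_le_left _ _
  refl x := by simp [hrefl]
  symm x y := by rw [max_comm]
  triangle x y z := by
    have hmax : max (c x z) (c z x) ≤ max (c x y) (c y x) + max (c y z) (c z y) := by
      refine max_le ((htri x y z).trans ?_) ((htri z y x).trans ?_)
      · exact add_le_add (le_max_left _ _) (le_max_left _ _)
      · rw [add_comm]
        exact add_le_add (le_max_right _ _) (le_max_right _ _)
    refine (min_le_min_left 1 hmax).trans ?_
    rw [min_add_distrib]
    exact min_le_right _ _

end Pseudometric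

section Bisimilarity

variable {L : Signature.{u}} {A : Type v} {M : PTS L A} {lam : ℝ≥0∞}
  {c d : Proc L → Proc L → ℝ≥0∞}

/-- Image-finiteness: a process has finitely many transitions with a given label. -/
def IsImageFinite (M : PTS L A) : Prop :=
  ∀ t a, {π | M t a π}.Finite

/-- The cost of simulating the transitions of `t` by `t'`, where relating the targets `π` and
`π'` costs `lam · K(d)(π, π')`. It is `⊤` if `t'` lacks a label that `t` has. -/
noncomputable def simCost (M : PTS L A) (lam : ℝ≥0∞) (d : Proc L → Proc L → ℝ≥0∞)
    (t t' : Proc L) : ℝ≥0∞ :=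
  ⨆ (a) (π) (_ : M t a π), ⨅ (π') (_ : M t' a π'), lam * kantorovich d π π'

theorem simCost_mono (h : c ≤ d) (t t' : Proc L) : simCost M lam c t t' ≤ simCost M lam d t t' :=
  iSup_mono fun _ => iSup₂_mono fun _ _ => iInf₂_mono fun _ _ =>
    mul_le_mul_right (kantorovich_mono h _ _) _

theorem iInf_le_simCost {t : Proc L} {a : A} {π : PMF (Proc L)} (h : M t a π) (t' : Proc L) :
    ⨅ (π') (_ : M t' a π'), lam * kantorovich d π π' ≤ simCost M lam d t t' :=
  le_iSup_of_le a (le_iSup₂_of_le π h le_rfl)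

theorem simCost_le {t t' : Proc L} {b : ℝ≥0∞}
    (h : ∀ a π, M t a π → ∃ π', M t' a π' ∧ lam * kantorovich d π π' ≤ b) :
    simCost M lam d t t' ≤ b := by
  refine iSup_le fun a => iSup₂_le fun π hπ => ?_
  obtain ⟨π', hπ', hle⟩ := h a π hπ
  exact (iInf₂_le π' hπ').trans hle

theorem simCost_self (hd : ∀ t, d t t = 0) (t : Proc L) : simCost M lam d t t = 0 :=
  le_antisymm (simCost_le fun _ π hπ => ⟨π, hπ, by rw [kantorovich_self hd, mul_zero]⟩) zero_le

theorem simCost_triangle (hd : ∀ x y z, d x z ≤ d x y + d y z) (t₁ t₂ t₃ : Proc L) :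
    simCost M lam d t₁ t₃ ≤ simCost M lam d t₁ t₂ + simCost M lam d t₂ t₃ := by
  refine iSup_le fun a => iSup₂_le fun π₁ h₁ => ?_
  refine le_trans ?_ (add_le_add_left (iInf_le_simCost h₁ t₂) _)
  simp only [ENNReal.iInf_add]
  refine le_iInf₂ fun π₂ h₂ => ?_
  refine le_trans ?_ (add_le_add_right (iInf_le_simCost h₂ t₃) _)
  simp only [ENNReal.add_iInf, ← mul_add]
  exact iInf₂_mono fun π₃ _ => mul_le_mul_right (kantorovich_triangle hd _ _ _) _

theorem IsImageFinite.exists_le_simCost (hM : IsImageFinite M) {t t' : Proc L}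
    (h : simCost M lam d t t' ≠ ⊤) {a : A} {π : PMF (Proc L)} (hπ : M t a π) :
    ∃ π', M t' a π' ∧ lam * kantorovich d π π' ≤ simCost M lam d t t' := by
  have hle := iInf_le_simCost (lam := lam) (d := d) hπ t'
  have hne : {π' | M t' a π'}.Nonempty := by
    by_contra! hempty
    refine h (top_le_iff.1 (le_trans (le_iInf₂ fun π' hπ' => ?_) hle))
    exact (Set.eq_empty_iff_forall_notMem.1 hempty π' hπ').elim
  obtain ⟨π', hπ', hmin⟩ :=
    Set.exists_min_image _ (fun π' => lam * kantorovich d π π') (hM t' a) hne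
  exact ⟨π', hπ', (le_iInf₂ hmin).trans hle⟩

/-- The functional whose prefixed points, among pseudometrics, are the bisimulation metrics. -/
noncomputable def bisimFunctional (M : PTS L A) (lam : ℝ≥0∞) :
    (Proc L → Proc L → ℝ≥0∞) →o (Proc L → Proc L → ℝ≥0∞) where
  toFun d t t' := min 1 (max (simCost M lam d t t') (simCost M lam d t' t))
  monotone' _ _ h _ _ := min_le_min_left 1 (max_le_max (simCost_mono h _ _) (simCost_mono h _ _))

theorem bisimFunctional_apply (t t' : Proc L) : bisimFunctional M lam d t t' =
    min 1 (max (simCost M lam d t t') (simCost M lam d t' t)) :=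
  rfl

theorem bisimFunctional_comm (t t' : Proc L) :
    bisimFunctional M lam d t t' = bisimFunctional M lam d t' t := by
  rw [bisimFunctional_apply, bisimFunctional_apply, max_comm]

theorem IsPseudometric.bisimFunctional (hd : IsPseudometric d) :
    IsPseudometric (bisimFunctional M lam d) :=
  isPseudometric_min_one_max (simCost_self hd.refl) (simCost_triangle hd.triangle)

theorem IsImageFinite.exists_le_bisimFunctional (hM : IsImageFinite M) {t t' : Proc L}
    (h : bisimFunctional M lam d t t' < 1) {a : A} {π : PMF (Proc L)} (hπ : M t a π) :
    ∃ π', M t' a π' ∧ lam * kantorovich d π π' ≤ bisimFunctional M lam d t t' := by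
  have hle : simCost M lam d t t' ≤ bisimFunctional M lam d t t' := by
    rw [bisimFunctional_apply] at h ⊢
    rw [min_eq_right (min_lt_iff.1 h |>.resolve_left (lt_irrefl _)).le]
    exact le_max_left _ _
  obtain ⟨π', hπ', hK⟩ := hM.exists_le_simCost ((hle.trans_lt h).trans ENNReal.one_lt_top).ne hπ
  exact ⟨π', hπ', hK.trans hle⟩

theorem IsBisimMetric.bisimFunctional_le (hd : IsBisimMetric M lam d) :
    bisimFunctional M lam d ≤ d := by
  intro t t'
  rcases (hd.pseudometric.le_one t t').lt_or_eq with h | h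
  · refine (min_le_right _ _).trans (max_le (simCost_le (hd.transfer t t' h)) ?_)
    rw [hd.pseudometric.symm] at h ⊢
    exact simCost_le (hd.transfer t' t h)
  · exact (min_le_left _ _).trans_eq h.symm

theorem isPseudometric_lfp_bisimFunctional :
    IsPseudometric (bisimFunctional M lam).lfp :=
  OrderHom.lfp_induction _ (fun _ hd _ => hd.bisimFunctional) fun _ => isPseudometric_sSup

theorem IsImageFinite.isBisimMetric_lfp (hM : IsImageFinite M) :
    IsBisimMetric M lam (bisimFunctional M lam).lfp where
  pseudometric := isPseudometric_lfp_bisimFunctional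
  transfer t t' h a π hπ := by
    have hfix := congrFun₂ (bisimFunctional M lam).map_lfp t t'
    rw [← hfix] at h ⊢
    exact hM.exists_le_bisimFunctional h hπ

theorem IsImageFinite.isBisimilarityMetric_lfp (hM : IsImageFinite M) :
    IsBisimilarityMetric M lam (bisimFunctional M lam).lfp :=
  ⟨hM.isBisimMetric_lfp, fun _ he => OrderHom.lfp_le _ he.bisimFunctional_le⟩

theorem PTSS.isImageFinite_inducedModel (P : PTSS L A) : IsImageFinite P.inducedModel := by
  intro t
  induction t with
  | var x => exact x.elim
  | func f ts ih =>
    intro a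
    refine ((P.finite_rules f a).biUnion fun r _ =>
      (Set.Finite.pi' fun k => ih (r.pos k).1 (r.pos k).2).image (r.target.eval ts)).subset ?_
    intro π hπ
    rw [Set.mem_ofPred_eq, PTSS.inducedModel] at hπ
    obtain ⟨r, hr, ρ, hp, ha, rfl⟩ := hπ
    exact Set.mem_biUnion (x := r) ⟨hr, ha.symm⟩ ⟨ρ, hp.1, rfl⟩

end Bisimilarity

/-! ### Linear specifications -/

section Weight

variable {L : Signature.{u}} {V Vs Vd : Type}

/-- The total weight of the occurrences of variables in a state term, if `x` has weight `w x`. -/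
noncomputable def termWeight (w : V → ℝ≥0∞) : L.Term V → ℝ≥0∞
  | .var x => w x
  | .func _ ts => ∑ i, termWeight w (ts i)

/-- The total weight of the occurrences of variables in a distribution term, averaged over convex
combinations, if state variables `x` have weight `w x` and distribution variables `μ` have
weight `w' μ`. -/
noncomputable def DTerm.weight (w : Vs → ℝ≥0∞) (w' : Vd → ℝ≥0∞) : DTerm L Vs Vd → ℝ≥0∞
  | .var μ => w' μ
  | .dirac t => termWeight w t
  | .sum p θ => ∑' i, p i * weight w w' (θ i)
  | .app _ θ => ∑ i, weight w w' (θ i)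

theorem DTerm.weight_sum_le {w : Vs → ℝ≥0∞} {w' : Vd → ℝ≥0∞} {I : Type} (p : PMF I)
    {θ : I → DTerm L Vs Vd} {b : ℝ≥0∞} (h : ∀ i, (θ i).weight w w' ≤ b) :
    (DTerm.sum p θ).weight w w' ≤ b := by
  rw [weight]
  calc ∑' i, p i * (θ i).weight w w'
      ≤ ∑' i, p i * b := by gcongr with i; exact h i
    _ = b := by rw [ENNReal.tsum_mul_right, p.tsum_coe, one_mul]

end Weight

/-- Linearity of a rule: each argument is used at most once in the target, where the distributions
that a premise derives from `x_i` count as uses of `x_i`, and uses are averaged over convex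
combinations. Quantifying over all weights `w` of the arguments avoids counting occurrences. -/
def PGSOSRule.IsLinear {L : Signature.{u}} {A : Type v} {n : ℕ} (r : PGSOSRule L A n) : Prop :=
  ∀ w : Fin n → ℝ≥0∞, r.target.weight w (fun k => w (r.pos k).1) ≤ ∑ i, w i

/-- A specification is linear if all of its rules are. -/
def PTSS.IsLinear {L : Signature.{u}} {A : Type v} (P : PTSS L A) : Prop :=
  ∀ {n : ℕ} (f : L.Functions n), ∀ r ∈ P.rules f, r.IsLinear

section NonExpansive

variable {L₁ : Signature.{w}} {L : Signature.{u}} {A : Type v} {ι : L₁.LHom L}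
  {lam : ℝ≥0∞} {d : Proc L → Proc L → ℝ≥0∞}

theorem nonExpansive_sSup {n : ℕ} {f : L.Functions n} {S : Set (Proc L → Proc L → ℝ≥0∞)}
    (hS : ∀ d ∈ S, NonExpansive d f) : NonExpansive (sSup S) f := by
  intro s t
  simp only [sSup_apply, iSup_apply]
  exact iSup_le fun d => (hS d d.2 s t).trans
    (Finset.sum_le_sum fun i _ => le_iSup (fun e : S => (e : Proc L → Proc L → ℝ≥0∞) _ _) d)

theorem dist_subst_onTerm_le (hd : ∀ {n : ℕ} (f : L₁.Functions n), NonExpansive d (ι.onFunction f))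
    {V : Type} {s t : V → Proc L} {w : V → ℝ≥0∞} (hst : ∀ x, d (s x) (t x) ≤ w x)
    (u : L₁.Term V) : d ((ι.onTerm u).subst s) ((ι.onTerm u).subst t) ≤ termWeight w u := by
  induction u with
  | var x => exact hst x
  | func f us ih => exact (hd f _ _).trans (Finset.sum_le_sum fun i _ => ih i)

theorem kantorovich_map_func_le {n : ℕ} {f : L.Functions n} (hf : NonExpansive d f)
    (π π' : Fin n → PMF (Proc L)) :
    kantorovich d ((prodPMF π).map fun ts => .func f ts) ((prodPMF π').map fun ts => .func f ts) ≤
      ∑ i, kantorovich d (π i) (π' i) :=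
  calc _ ≤ kantorovich (fun s t : Fin n → Proc L => d (.func f s) (.func f t))
          (prodPMF π) (prodPMF π') := kantorovich_map_le _ _ _ _ _
    _ ≤ kantorovich (fun s t : Fin n → Proc L => ∑ i, d (s i) (t i)) (prodPMF π) (prodPMF π') :=
        kantorovich_mono hf _ _
    _ ≤ ∑ i, kantorovich d (π i) (π' i) := kantorovich_prodPMF_le d π π'

theorem mul_kantorovich_eval_onLHom_le (hlam : lam ≤ 1)
    (hd : ∀ {n : ℕ} (f : L₁.Functions n), NonExpansive d (ι.onFunction f)) {Vs Vd : Type}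
    {s t : Vs → Proc L} {ρ ρ' : Vd → PMF (Proc L)} {w : Vs → ℝ≥0∞} {w' : Vd → ℝ≥0∞}
    (hst : ∀ x, d (s x) (t x) ≤ w x) (hρ : ∀ μ, lam * kantorovich d (ρ μ) (ρ' μ) ≤ w' μ)
    (θ : DTerm L₁ Vs Vd) :
    lam * kantorovich d ((θ.onLHom ι).eval s ρ) ((θ.onLHom ι).eval t ρ') ≤ θ.weight w w' := by
  induction θ with
  | var μ => exact hρ μ
  | dirac u =>
    exact (mul_le_of_le_one_left' hlam).trans
      ((kantorovich_pure_le d _ _).trans (dist_subst_onTerm_le hd hst u))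
  | sum p θ ih =>
    refine (mul_le_mul_right (kantorovich_bind_le d p _ _) lam).trans ?_
    rw [← ENNReal.tsum_mul_left]
    refine ENNReal.tsum_le_tsum fun i => ?_
    rw [mul_left_comm]
    exact mul_le_mul_right (ih i) _
  | app f θ ih =>
    refine (mul_le_mul_right (kantorovich_map_func_le (hd f) _ _) lam).trans ?_
    rw [Finset.mul_sum]
    exact Finset.sum_le_sum fun i _ => ih i

theorem PGSOSRule.Premises.exists_le_bisimFunctional {M : PTS L A} (hM : IsImageFinite M) {n : ℕ}
    {r : PGSOSRule L A n} {s t : Fin n → Proc L}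
    (hst : ∀ i, bisimFunctional M lam d (s i) (t i) < 1) {ρ : Fin r.numPos → PMF (Proc L)}
    (h : r.Premises M s ρ) :
    ∃ ρ', r.Premises M t ρ' ∧ ∀ k, lam * kantorovich d (ρ k) (ρ' k) ≤
      bisimFunctional M lam d (s (r.pos k).1) (t (r.pos k).1) := by
  choose ρ' hρ' hle using fun k => hM.exists_le_bisimFunctional (hst (r.pos k).1) (h.1 k)
  refine ⟨ρ', ⟨hρ', fun q hq π hπ => ?_⟩, hle⟩
  obtain ⟨π', hπ', -⟩ := hM.exists_le_bisimFunctional (bisimFunctional_comm _ _ ▸ hst q.1) hπ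
  exact h.2 q hq π' hπ'

variable {P₁ : PTSS L₁ A} {P : PTSS L A}

theorem PTSS.IsDisjointExtension.inducedModel_func_iff (hP : PTSS.IsDisjointExtension ι P₁ P)
    {n : ℕ} {f : L₁.Functions n} {s : Fin n → Proc L} {a : A} {π : PMF (Proc L)} :
    P.inducedModel (.func (ι.onFunction f) s) a π ↔
      ∃ r ∈ P₁.rules f, ∃ ρ, (r.onLHom ι).Premises P.inducedModel s ρ ∧
        a = r.act ∧ π = (r.target.onLHom ι).eval s ρ := by
  rw [PTSS.inducedModel, hP.rules_eq, Set.exists_mem_image]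
  rfl

theorem simCost_func_le (hP : PTSS.IsDisjointExtension ι P₁ P) (hP₁ : P₁.IsLinear)
    (hlam : lam ≤ 1) (hle : d ≤ bisimFunctional P.inducedModel lam d)
    (hd : ∀ {n : ℕ} (f : L₁.Functions n), NonExpansive d (ι.onFunction f))
    {n : ℕ} (f : L₁.Functions n) {s t : Fin n → Proc L}
    (hst : ∀ i, bisimFunctional P.inducedModel lam d (s i) (t i) < 1) :
    simCost P.inducedModel lam d (.func (ι.onFunction f) s) (.func (ι.onFunction f) t) ≤
      ∑ i, bisimFunctional P.inducedModel lam d (s i) (t i) := by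
  refine simCost_le fun a π hπ => ?_
  obtain ⟨r, hr, ρ, hρ, rfl, rfl⟩ := hP.inducedModel_func_iff.1 hπ
  obtain ⟨ρ', hρ', hK⟩ := hρ.exists_le_bisimFunctional P.isImageFinite_inducedModel hst
  refine ⟨_, hP.inducedModel_func_iff.2 ⟨r, hr, ρ', hρ', rfl, rfl⟩, ?_⟩
  exact (mul_kantorovich_eval_onLHom_le hlam hd (fun i => hle (s i) (t i)) hK r.target).trans
    (hP₁ f r hr _)

theorem nonExpansive_bisimFunctional (hP : PTSS.IsDisjointExtension ι P₁ P) (hP₁ : P₁.IsLinear)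
    (hlam : lam ≤ 1) (hle : d ≤ bisimFunctional P.inducedModel lam d)
    (hd : ∀ {n : ℕ} (f : L₁.Functions n), NonExpansive d (ι.onFunction f))
    {n : ℕ} (f : L₁.Functions n) :
    NonExpansive (bisimFunctional P.inducedModel lam d) (ι.onFunction f) := by
  intro s t
  by_cases hst : ∀ i, bisimFunctional P.inducedModel lam d (s i) (t i) < 1
  · refine (min_le_right _ _).trans (max_le (simCost_func_le hP hP₁ hlam hle hd f hst) ?_)
    simp only [bisimFunctional_comm (s _)] at hst ⊢
    exact simCost_func_le hP hP₁ hlam hle hd f hst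
  · push Not at hst
    obtain ⟨i, hi⟩ := hst
    exact (min_le_left _ _).trans (hi.trans (Finset.single_le_sum_of_canonicallyOrdered
      (f := fun i => bisimFunctional P.inducedModel lam d (s i) (t i)) (Finset.mem_univ i)))

theorem nonExpansive_lfp_bisimFunctional (hP : PTSS.IsDisjointExtension ι P₁ P)
    (hP₁ : P₁.IsLinear) (hlam : lam ≤ 1) {n : ℕ} (f : L₁.Functions n) :
    NonExpansive (bisimFunctional P.inducedModel lam).lfp (ι.onFunction f) := by
  let Φ := bisimFunctional P.inducedModel lam
  suffices h : Φ.lfp ≤ Φ Φ.lfp ∧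
      ∀ {n : ℕ} (f : L₁.Functions n), NonExpansive Φ.lfp (ι.onFunction f) from h.2 f
  refine OrderHom.lfp_induction (p := fun d => d ≤ Φ d ∧
    ∀ {n : ℕ} (f : L₁.Functions n), NonExpansive d (ι.onFunction f)) Φ ?_ ?_
  · rintro d ⟨hle, hd⟩ -
    exact ⟨Φ.monotone hle, nonExpansive_bisimFunctional hP hP₁ hlam hle hd⟩
  · intro S hS
    exact ⟨sSup_le fun d hd => (hS d hd).1.trans (Φ.monotone (le_sSup hd)),
      fun f => nonExpansive_sSup fun d hd => (hS d hd).2 f⟩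

end NonExpansive

/-! ### Linearity of `PA` -/

section PA

variable {A : Type v} {n : ℕ}

theorem isLinear_of_target_eq_var {r : PGSOSRule (paSig A) A n} {k : Fin r.numPos}
    (h : r.target = .var k) : r.IsLinear := by
  intro w
  rw [h]
  exact Finset.single_le_sum_of_canonicallyOrdered (f := w) (Finset.mem_univ _)

theorem isLinear_of_target_eq_dnil {r : PGSOSRule (paSig A) A n} (h : r.target = dnil) :
    r.IsLinear := by
  intro w
  simp [h, dnil, DTerm.weight, termWeight]

theorem isLinear_of_target_eq_bin {r : PGSOSRule (paSig A) A 2} {f : PAOp A 2}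
    {θ₁ θ₂ : Tgt A r.numPos} (h : r.target = bin f θ₁ θ₂)
    (h₁ : (fun w => θ₁.weight w fun k => w (r.pos k).1) ≤ fun w => w 0)
    (h₂ : (fun w => θ₂.weight w fun k => w (r.pos k).1) ≤ fun w => w 1) : r.IsLinear := by
  intro w
  rw [h, Fin.sum_univ_two]
  exact (Fin.sum_univ_two _).trans_le (add_le_add (h₁ w) (h₂ w))

theorem isLinear_ruleLR_choice {a b : A} {p : ℝ≥0∞} {hp : p ≤ 1} {θ₁ θ₂ : Tgt A 2}
    (h₁ : (ruleLR b a θ₁).IsLinear) (h₂ : (ruleLR b a θ₂).IsLinear) :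
    (ruleLR b a (.choice p hp θ₁ θ₂)).IsLinear :=
  fun w => DTerm.weight_sum_le _ (Fin.forall_fin_two.2 ⟨h₁ w, h₂ w⟩)

theorem paPTSS_isLinear (tick : A) : (paPTSS tick).IsLinear := by
  intro n f r hr
  cases f with
  | nil => exact hr.elim
  | skip => exact isLinear_of_target_eq_dnil (hr ▸ rfl)
  | pre a p hp =>
    obtain rfl := hr
    exact fun w => DTerm.weight_sum_le p fun i =>
      Finset.single_le_sum_of_canonicallyOrdered (Finset.mem_univ i)
  | seq =>
    obtain ⟨a, -, rfl⟩ | ⟨a, rfl⟩ := hr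
    · exact isLinear_of_target_eq_bin rfl le_rfl le_rfl
    · exact isLinear_of_target_eq_var rfl
  | alt => obtain ⟨a, rfl⟩ | ⟨a, rfl⟩ := hr <;> exact isLinear_of_target_eq_var rfl
  | palt p h₀ h =>
    obtain (⟨a, rfl⟩ | ⟨a, rfl⟩) | ⟨a, rfl⟩ := hr
    · exact isLinear_of_target_eq_var rfl
    · exact isLinear_of_target_eq_var rfl
    · exact isLinear_ruleLR_choice (isLinear_of_target_eq_var rfl) (isLinear_of_target_eq_var rfl)
  | sync =>
    obtain ⟨a, -, rfl⟩ | rfl := hr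
    · exact isLinear_of_target_eq_bin rfl le_rfl le_rfl
    · exact isLinear_of_target_eq_dnil rfl
  | async =>
    obtain (⟨a, -, rfl⟩ | ⟨a, -, rfl⟩) | rfl := hr
    · exact isLinear_of_target_eq_bin rfl le_rfl le_rfl
    · exact isLinear_of_target_eq_bin rfl le_rfl le_rfl
    · exact isLinear_of_target_eq_dnil rfl
  | pasync p h₀ h =>
    obtain ((⟨a, -, rfl⟩ | ⟨a, -, rfl⟩) | ⟨a, -, rfl⟩) | rfl := hr
    · exact isLinear_of_target_eq_bin rfl le_rfl le_rfl
    · exact isLinear_of_target_eq_bin rfl le_rfl le_rfl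
    · exact isLinear_ruleLR_choice (isLinear_of_target_eq_bin rfl le_rfl le_rfl)
        (isLinear_of_target_eq_bin rfl le_rfl le_rfl)
    · exact isLinear_of_target_eq_dnil rfl
  | csp B =>
    obtain ((⟨a, -, rfl⟩ | rfl) | ⟨a, -, rfl⟩) | ⟨a, -, rfl⟩ := hr
    · exact isLinear_of_target_eq_bin rfl le_rfl le_rfl
    · exact isLinear_of_target_eq_dnil rfl
    · exact isLinear_of_target_eq_bin rfl le_rfl le_rfl
    · exact isLinear_of_target_eq_bin rfl le_rfl le_rfl

end PA

end ProbPA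

theorem mainTheorem5_general {L₁ : ProbPA.Signature.{w}} {L : ProbPA.Signature.{u}} {A : Type v}
    {P₁ : ProbPA.PTSS L₁ A} {P : ProbPA.PTSS L A} {ι : L₁.LHom L}
    (hP : ProbPA.PTSS.IsDisjointExtension ι P₁ P) (hP₁ : P₁.IsLinear)
    {lam : ℝ≥0∞} (hlam : lam ≤ 1) :
    ∃ d : ProbPA.Proc L → ProbPA.Proc L → ℝ≥0∞, ProbPA.IsBisimilarityMetric P.inducedModel lam d ∧
      ∀ {n : ℕ} (f : L₁.Functions n), ProbPA.NonExpansive d (ι.onFunction f) :=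
  ⟨_, P.isImageFinite_inducedModel.isBisimilarityMetric_lfp,
    fun f => ProbPA.nonExpansive_lfp_bisimFunctional hP hP₁ hlam f⟩

/-- In every disjoint extension `P` of the process algebra `P_PA` (along the inclusion `ι` of
signatures) the `lam`-bisimilarity metric exists, and every operator of `Σ_PA` is non-expansive
with respect to it. -/
theorem mainTheorem5 {A : Type v} (tick : A) {L : ProbPA.Signature.{u}} (P : ProbPA.PTSS L A)
    (ι : (ProbPA.paSig A).LHom L) (hP : ProbPA.PTSS.IsDisjointExtension ι (ProbPA.paPTSS tick) P)
    (lam : ℝ≥0∞) (hlam₀ : 0 < lam) (hlam₁ : lam ≤ 1) :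
    ∃ d : ProbPA.Proc L → ProbPA.Proc L → ℝ≥0∞, ProbPA.IsBisimilarityMetric P.inducedModel lam d ∧
      ∀ {n : ℕ} (f : ProbPA.PAOp A n), ProbPA.NonExpansive d (ι.onFunction f) :=
  mainTheorem5_general hP (ProbPA.paPTSS_isLinear tick) hlam₁
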